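/- Let $p,q\ge 1$ be integers, $a,b\in\mathbb R$, and $s>5/2$. Let $u_0,v_0\in H^s(\mathbb R)$ be real-valued, and let $(u,v)$ be a solution on a time interval $[0,T)$, $0<T\le\infty$ (for example the maximal interval of existence), with $u,v\in C([0,T);H^s(\mathbb R))\cap C^1([0,T);H^{s-1}(\mathbb R))$, of the Cauchy problem $$m_t+v^p m_x+a\,v^{p-1}v_x m=0,\qquad n_t+u^q n_x+b\,u^{q-1}u_x n=0,\qquad u(\cdot,0)=u_0,\quad v(\cdot,0)=v_0,$$ where $m=(1-\partial_x^2)u$, $n=(1-\partial_x^2)v$ and the two equations hold in the sense of distributions on $\mathbb R$ for each $t\in[0,T)$. (Elements of $H^s$ are identified with their continuous representatives.) Put $m_0=(1-\partial_x^2)u_0$ and $n_0=(1-\partial_x^2)v_0$. Then for each $t\in[0,T)$ the functions $m(\cdot,t)$ and $n(\cdot,t)$ are continuous, and of class $C^1$ if $s>7/2$. The characteristic flows $$\phi_t=v^p(\phi,t),\quad \phi(x,0)=x,\qquad\qquad \varphi_t=u^q(\varphi,t),\quad \varphi(x,0)=x\qquad (x\in\mathbb R,\ t\in[0,T))$$ exist,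 and: (i) if $m_0$ has compact support, then for every $t\in[0,T)$ the function $m(\cdot,t)$ has compact support, and $\operatorname{supp} m(\cdot,t)\subseteq\phi(\operatorname{supp} m_0,t)$ for every such flow $\phi$; (ii) if $n_0$ has compact support, then for every $t\in[0,T)$ the function $n(\cdot,t)$ has compact support, and $\operatorname{supp} n(\cdot,t)\subseteq\varphi(\operatorname{supp} n_0,t)$ for every such flow $\varphi$. -/

import Mathlib

open MeasureTheory Set TemperedDistribution
open scoped SchwartzMap ContDiff

noncomputable section

namespace CrossCoupledCH

/-- The operator `1 - ∂ₓ²` (classical derivatives). -/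
def helmholtz (f : ℝ → ℝ) (x : ℝ) : ℝ := f x - deriv (deriv f) x

/-- `f ∈ Hˢ(ℝ)` (for `s ≥ 0`) for a real-valued function `f`: `f` is square integrable and the
tempered distribution that it defines belongs to the Sobolev space of order `s`, that is,
`(1 + |ξ|²)^{s/2}` times the Fourier transform of `f` is in `L²`. -/
def MemHs (s : ℝ) (f : ℝ → ℝ) : Prop :=
  ∃ h : MemLp (fun x => (f x : ℂ)) 2 (volume : Measure ℝ),
    MemSobolev s 2 ((h.toLp (fun x => (f x : ℂ)) : Lp ℂ 2 (volume : Measure ℝ)) : 𝓢'(ℝ, ℂ))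

/-- `u ∈ Cᵏ(J; Hˢ(ℝ))` (for `s ≥ 0`). The Bessel potential of order `s` identifies `Hˢ` with `L²`
(isometrically, by the definition of the `Hˢ` norm), so `u` is of class `Cᵏ` with values in `Hˢ`
exactly if its image under the Bessel potential is of class `Cᵏ` with values in `L²`. -/
def MemCkHs (k : ℕ) (s : ℝ) (J : Set ℝ) (u : ℝ → ℝ → ℝ) : Prop :=
  ∃ g : ℝ → Lp ℂ 2 (volume : Measure ℝ), ContDiffOn ℝ k g J ∧
    ∀ t ∈ J, ∃ h : MemLp (fun x => (u t x : ℂ)) 2 (volume : Measure ℝ),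
      besselPotential ℝ ℂ s
        ((h.toLp (fun x => (u t x : ℂ)) : Lp ℂ 2 (volume : Measure ℝ)) : 𝓢'(ℝ, ℂ)) =
          (g t : 𝓢'(ℝ, ℂ))

/-- The time interval `[0, T)`, where `0 < T ≤ ∞`. -/
def timeInterval (T : EReal) : Set ℝ := {t | 0 ≤ t ∧ (t : EReal) < T}

/-- `w_t + c ^ p * w_x + a * c ^ (p - 1) * c_x * w = 0` in the sense of distributions on `ℝ`, at
every time of the interval `J`. In the time derivative `w_t` (one-sided at a left endpoint of `J`)
and in the term `c ^ p * w_x` the derivatives are moved to the test function. -/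
def SolvesTransport (J : Set ℝ) (p : ℕ) (a : ℝ) (c w : ℝ → ℝ → ℝ) : Prop :=
  ∀ ψ : ℝ → ℝ, ContDiff ℝ ∞ ψ → HasCompactSupport ψ → ∀ t ∈ J,
    HasDerivWithinAt (fun τ => ∫ x, w τ x * ψ x)
      ((∫ x, w t x * deriv (fun y => c t y ^ p * ψ y) x)
        - ∫ x, a * c t x ^ (p - 1) * deriv (c t) x * w t x * ψ x) J t

/-- `(u, v)` is an `Hˢ` solution (`s > 5/2`) on `[0, T)` of the Cauchy problem
`m_t + v^p m_x + a v^{p-1} v_x m = 0`, `n_t + u^q n_x + b u^{q-1} u_x n = 0`,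
`u(0) = u₀`, `v(0) = v₀`, where `m = u - u_xx` and `n = v - v_xx`. The functions `u(t)`, `v(t)` are
the continuous representatives of their classes. By the Sobolev embedding they are then of
class `C²`, so that `m(t)` and `n(t)` are continuous functions. -/
structure IsSolution (p q : ℕ) (a b s : ℝ) (T : EReal) (u₀ v₀ : ℝ → ℝ)
    (u v : ℝ → ℝ → ℝ) : Prop where
  continuous_u : ∀ t ∈ timeInterval T, Continuous (u t)
  continuous_v : ∀ t ∈ timeInterval T, Continuous (v t)
  mem_u : MemCkHs 0 s (timeInterval T) u
  mem_v : MemCkHs 0 s (timeInterval T) v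
  mem_u' : MemCkHs 1 (s - 1) (timeInterval T) u
  mem_v' : MemCkHs 1 (s - 1) (timeInterval T) v
  eq_m : SolvesTransport (timeInterval T) p a v (fun t => helmholtz (u t))
  eq_n : SolvesTransport (timeInterval T) q b u (fun t => helmholtz (v t))
  init_u : u 0 = u₀
  init_v : v 0 = v₀

/-- `φ` is the flow on the time interval `J`, started at time `0`, of the time-dependent vector
field `c`: `φ(0, x) = x` and `φ_t(t, x) = c(t, φ(t, x))`. -/
def IsFlow (J : Set ℝ) (c φ : ℝ → ℝ → ℝ) : Prop :=
  ∀ x, φ 0 x = x ∧ ∀ t ∈ J, HasDerivWithinAt (fun τ => φ τ x) (c t (φ t x)) J t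

end CrossCoupledCH

end

/-!
The equation for `m` is a linear transport equation `w_t + V w_x + e w = 0` with `V = v ^ p` and
`e = a v ^ (p - 1) v_x`, so formally `w` solves the linear equation `z' = -e z` along every
characteristic `γ' = V(t, γ)`, and a zero of `w` at time `0` is carried along by the flow. The
points where `m(t)` is nonzero are therefore images under the flow of points where `m₀` is nonzero.
The equation for `n` has the same form.

Two ingredients make this rigorous.

* The Sobolev embedding `Hˢ ⊆ Cᵏ` for `s > k + 1/2` (`exists_norm_iteratedDeriv_le`): after the
  Bessel potential is inverted on the Fourier side, the function is the inverse Fourier transform of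
  `(1 + |ξ|²)^{-s/2}` times an `L²` function, and the Cauchy-Schwarz inequality bounds the moments up
  to order `k` of this product. For a continuous curve in `Hˢ` the space derivatives up to order `k`
  are jointly continuous and bounded on compact time intervals (`MemCkHs.iteratedDeriv_bound`). As
  `s > 5/2`, this applies to `u`, `u_x`, `u_xx`, `v`, `v_x`, `v_xx`. Hence `V` is bounded and
  Lipschitz in space, its flow exists on the whole time interval, and the time-`t` maps are
  continuous and surjective.
* Propagation of zeros for a `w` that is merely continuous and solves the equation in the sense of
  distributions (`eq_zero_of_transport`). The equation is tested with a mollifier `η` of width `ε`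
  centred at the moving point `γ(t)`. The commutator is
  `∫ w(y) k(y) dy` with `k(y) = ∂_y [(V(y) - V(γ)) η(γ - y)]`. Since `∫ k = 0`
  and `∫ |k|` is bounded independently of `ε`, it is controlled by the oscillation of `w` on the
  interval of radius `ε` about `γ(t)`, which tends to zero uniformly in `t`. Grönwall's inequality
  for the mollified function then gives `w(t, γ(t)) = 0`.
-/

namespace CrossCoupledCH

open FourierTransform Filter Topology
open scoped NNReal

/-! ### Sobolev embedding for `Hˢ(ℝ)` -/

/-- Inversion of the Bessel potential. The identity holds at every point, not only almost everywhere,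
because both sides are continuous. -/
theorem eq_fourierInv_of_besselPotential_eq {s : ℝ} {f : ℝ → ℂ}
    (hf : Continuous f) (h : MemLp f 2 (volume : Measure ℝ)) {g : Lp ℂ 2 (volume : Measure ℝ)}
    (hg : besselPotential ℝ ℂ s ((h.toLp f : Lp ℂ 2 (volume : Measure ℝ)) : 𝓢'(ℝ, ℂ)) = g)
    (hH : Integrable fun ξ : ℝ =>
      (((1 + ‖ξ‖ ^ 2) ^ (-s / 2) : ℝ) : ℂ) * (𝓕 g : Lp ℂ 2 (volume : Measure ℝ)) ξ) :
    f = 𝓕⁻ fun ξ : ℝ =>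
      (((1 + ‖ξ‖ ^ 2) ^ (-s / 2) : ℝ) : ℂ) * (𝓕 g : Lp ℂ 2 (volume : Measure ℝ)) ξ := by
  set H := fun ξ : ℝ =>
    (((1 + ‖ξ‖ ^ 2) ^ (-s / 2) : ℝ) : ℂ) * (𝓕 g : Lp ℂ 2 (volume : Measure ℝ)) ξ with hHdef
  have hdist : ∀ ψ : 𝓢(ℝ, ℂ), ∫ x, ψ x * f x = ∫ x, ψ x * 𝓕⁻ H x := by
    intro ψ
    have h1 : ((h.toLp f : Lp ℂ 2 (volume : Measure ℝ)) : 𝓢'(ℝ, ℂ)) =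
        besselPotential ℝ ℂ (-s) g := by
      rw [eq_comm, besselPotential_neg_apply_eq_iff, hg]
    have h2 := congrArg (fun D : 𝓢'(ℝ, ℂ) => D ψ) h1
    simp only [besselPotential, fourierMultiplierCLM_apply, Lp.toTemperedDistribution_apply,
      fourierInv_apply, Lp.fourier_toTemperedDistribution_eq, smulLeftCLM_apply_apply] at h2
    have h3 : ∫ x, ψ x * f x = ∫ x, 𝓕⁻ (ψ : ℝ → ℂ) x * H x := by
      calc _ = ∫ x, ψ x • (h.toLp f : Lp ℂ 2 (volume : Measure ℝ)) x := by
            apply integral_congr_ae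
            filter_upwards [h.coeFn_toLp] with x hx
            rw [hx, smul_eq_mul]
        _ = _ := by
            rw [h2]
            congr 1
            ext x
            rw [SchwartzMap.smulLeftCLM_apply_apply (by fun_prop), SchwartzMap.fourierInv_coe]
            simp only [hHdef, smul_eq_mul]
            ring
    rw [h3]
    have h4 := VectorFourier.integral_fourierIntegral_smul_eq_flip (L := -innerₗ ℝ)
      (μ := volume) (ν := volume) (f := (ψ : ℝ → ℂ)) (g := H)
      Real.continuous_fourierChar (by simp; fun_prop) ψ.integrable hH
    -- The inverse transform is the Fourier integral for the negated pairing, which is symmetric.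
    have h5 : ∀ F : ℝ → ℂ, 𝓕⁻ F = VectorFourier.fourierIntegral Real.fourierChar volume
      (-innerₗ ℝ) F := fun F => rfl
    have h6 : (-innerₗ ℝ).flip = -innerₗ ℝ := by ext; simp
    rw [h6] at h4
    rw [h5, h5]
    simpa using h4
  have hHc : Continuous (𝓕⁻ H) := by
    have := VectorFourier.fourierIntegral_continuous (L := -innerₗ ℝ) (μ := volume)
      Real.continuous_fourierChar (by simp; fun_prop) hH
    exact this
  have hae : f =ᵐ[volume] 𝓕⁻ H := by
    apply ae_eq_of_integral_contDiff_smul_eq hf.locallyIntegrable hHc.locallyIntegrable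
    intro ψ hψ hψc
    have hg₁ : HasCompactSupport (Complex.ofRealCLM ∘ ψ) := hψc.comp_left rfl
    have hg₂ : ContDiff ℝ ∞ (Complex.ofRealCLM ∘ ψ) := by fun_prop
    have := hdist (hg₁.toSchwartzMap hg₂)
    simpa using this
  exact (hf.ae_eq_iff_eq volume hHc).1 hae

/-- The moment of order `k` of `(1 + |ξ|²)^{-s/2} G` is bounded by the `L²` norm of `G`: by the
Cauchy-Schwarz inequality, because `|ξ|ᵏ (1 + |ξ|²)^{-s/2}` is square integrable. -/
theorem exists_integral_pow_mul_weight_le {s : ℝ} {k : ℕ} (hk : k + 1 / 2 < s) :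
    ∃ C : ℝ, ∀ G : Lp ℂ 2 (volume : Measure ℝ),
      Integrable (fun ξ : ℝ => ‖ξ‖ ^ k * ‖(((1 + ‖ξ‖ ^ 2) ^ (-s / 2) : ℝ) : ℂ) * G ξ‖) ∧
      ∫ ξ : ℝ, ‖ξ‖ ^ k * ‖(((1 + ‖ξ‖ ^ 2) ^ (-s / 2) : ℝ) : ℂ) * G ξ‖ ≤ C * ‖G‖ := by
  set W : ℝ → ℂ := fun ξ => (‖ξ‖ ^ k * (1 + ‖ξ‖ ^ 2) ^ (-s / 2) : ℝ) with hW
  have hWc : Continuous W := by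
    have h1 : ∀ ξ : ℝ, (1 + ‖ξ‖ ^ 2) ≠ 0 := fun ξ => by positivity
    have : Continuous fun ξ : ℝ => (1 + ‖ξ‖ ^ 2) ^ (-s / 2) :=
      Continuous.rpow_const (by fun_prop) (fun ξ => Or.inl (h1 ξ))
    fun_prop
  have hW2 : MemLp W 2 (volume : Measure ℝ) := by
    rw [memLp_two_iff_integrable_sq_norm hWc.aestronglyMeasurable]
    have hr : ((Module.finrank ℝ ℝ : ℕ) : ℝ) < 2 * (s - k) := by
      simp only [Module.finrank_self, Nat.cast_one]; linarith
    refine (integrable_rpow_neg_one_add_norm_sq (μ := (volume : Measure ℝ)) hr).mono'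
      (by fun_prop) (Filter.Eventually.of_forall fun ξ => ?_)
    have h0 : 0 < 1 + ‖ξ‖ ^ 2 := by positivity
    rw [hW]
    simp only [Complex.norm_real]
    rw [Real.norm_of_nonneg (by positivity), Real.norm_of_nonneg (by positivity), mul_pow,
      ← pow_mul, mul_comm k 2, pow_mul, ← Real.rpow_mul_natCast h0.le]
    calc (‖ξ‖ ^ 2) ^ k * (1 + ‖ξ‖ ^ 2) ^ (-s / 2 * (2 : ℕ))
        ≤ (1 + ‖ξ‖ ^ 2) ^ k * (1 + ‖ξ‖ ^ 2) ^ (-s / 2 * (2 : ℕ)) := by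
          gcongr; linarith
      _ = (1 + ‖ξ‖ ^ 2) ^ (-(2 * (s - k)) / 2) := by
          rw [← Real.rpow_natCast, ← Real.rpow_add h0]
          congr 1
          push_cast
          ring
  have hprod : ∀ (G : Lp ℂ 2 (volume : Measure ℝ)) (ξ : ℝ),
      ‖ξ‖ ^ k * ‖(((1 + ‖ξ‖ ^ 2) ^ (-s / 2) : ℝ) : ℂ) * G ξ‖ = ‖W ξ‖ * ‖G ξ‖ := by
    intro G ξ
    simp only [hW, norm_mul, Complex.norm_real, norm_pow, norm_norm]
    ring
  refine ⟨(∫ ξ, ‖W ξ‖ ^ (2 : ℝ)) ^ (1 / (2 : ℝ)), fun G => ?_⟩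
  simp_rw [hprod G]
  have hG : MemLp (G : ℝ → ℂ) 2 volume := Lp.memLp G
  refine ⟨hW2.norm.integrable_mul hG.norm, ?_⟩
  have h := integral_mul_norm_le_Lp_mul_Lq (p := 2) (q := 2) Real.HolderConjugate.two_two
    (by simpa using hW2) (by simpa using hG)
  refine h.trans (le_of_eq ?_)
  congr 1
  rw [Lp.norm_def, hG.eLpNorm_eq_integral_rpow_norm (by norm_num) (by norm_num),
    ENNReal.toReal_ofReal (by positivity)]
  simp

/-- The Sobolev embedding `Hˢ ⊆ Cᵏ` for `s > k + 1/2`, with its estimate for the `k`-th derivative.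
Here `‖g‖` is the `Hˢ` norm of `f`. -/
theorem exists_norm_iteratedDeriv_le {s : ℝ} {k : ℕ} (hk : k + 1 / 2 < s) :
    ∃ C : ℝ, ∀ (f : ℝ → ℝ) (_ : Continuous f)
      (h : MemLp (fun x => (f x : ℂ)) 2 (volume : Measure ℝ)) (g : Lp ℂ 2 (volume : Measure ℝ)),
      besselPotential ℝ ℂ s
        ((h.toLp (fun x => (f x : ℂ)) : Lp ℂ 2 (volume : Measure ℝ)) : 𝓢'(ℝ, ℂ)) = g →
      ContDiff ℝ k f ∧ ∀ x, ‖iteratedDeriv k f x‖ ≤ C * ‖g‖ := by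
  obtain ⟨C, hC⟩ := exists_integral_pow_mul_weight_le hk
  refine ⟨(2 * Real.pi) ^ k * C, fun f hf h g hg => ?_⟩
  set H := fun ξ : ℝ =>
    (((1 + ‖ξ‖ ^ 2) ^ (-s / 2) : ℝ) : ℂ) * (𝓕 g : Lp ℂ 2 (volume : Measure ℝ)) ξ with hHdef
  have hHm : AEStronglyMeasurable H volume := by
    apply AEStronglyMeasurable.mul _ (Lp.aestronglyMeasurable _)
    apply Continuous.aestronglyMeasurable
    have : Continuous fun ξ : ℝ => (1 + ‖ξ‖ ^ 2) ^ (-s / 2) :=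
      Continuous.rpow_const (by fun_prop) (fun ξ => Or.inl (by positivity))
    fun_prop
  have hint : ∀ n : ℕ, n ≤ (k : ℕ∞) → Integrable fun ξ : ℝ => ‖ξ‖ ^ n * ‖H ξ‖ := by
    intro n hn
    have hn' : n ≤ k := by exact_mod_cast hn
    have hns : (n : ℝ) + 1 / 2 < s := by
      have : (n : ℝ) ≤ k := by exact_mod_cast hn'
      linarith
    obtain ⟨_, h⟩ := exists_integral_pow_mul_weight_le hns
    exact (h (𝓕 g)).1
  have hH : Integrable H := by
    have := hint 0 (by simp)
    simp only [pow_zero, one_mul] at this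
    exact (integrable_norm_iff hHm).1 this
  have hrep := eq_fourierInv_of_besselPotential_eq (by fun_prop) h hg hH
  rw [← hHdef, Real.fourierInv_eq_fourier_comp_neg] at hrep
  -- Mathlib's differentiation formulas are for the direct transform, whence the reflection.
  set K : ℝ → ℂ := fun ξ => H (-ξ) with hK
  have hKint : ∀ n : ℕ, n ≤ (k : ℕ∞) → Integrable fun ξ : ℝ => ‖ξ‖ ^ n * ‖K ξ‖ := by
    intro n hn
    have := (hint n hn).comp_neg
    simpa [hK] using this
  have hKm : AEStronglyMeasurable K volume := hH.comp_neg.aestronglyMeasurable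
  have hfK : f = Complex.reCLM ∘ 𝓕 K := by
    ext x
    have := congrFun hrep x
    simp [← this]
  have hcd : ContDiff ℝ k (𝓕 K) := Real.contDiff_fourier (N := k) hKint
  refine ⟨by rw [hfK]; exact Complex.reCLM.contDiff.comp hcd, fun x => ?_⟩
  have h1 : ‖iteratedDeriv k f x‖ ≤ ‖iteratedDeriv k (𝓕 K) x‖ := by
    rw [← norm_iteratedFDeriv_eq_norm_iteratedDeriv, ← norm_iteratedFDeriv_eq_norm_iteratedDeriv,
      hfK, Complex.reCLM.iteratedFDeriv_comp_left hcd.contDiffAt le_rfl]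
    refine (ContinuousLinearMap.norm_compContinuousMultilinearMap_le _ _).trans ?_
    simp
  refine h1.trans ?_
  have hKi : ∀ n : ℕ, n ≤ (k : ℕ∞) → Integrable fun ξ : ℝ => ξ ^ n • K ξ := by
    intro n hn
    refine (integrable_norm_iff (by fun_prop)).1 ?_
    simpa [norm_smul] using hKint n hn
  rw [Real.iteratedDeriv_fourier (N := k) hKi le_rfl]
  refine (VectorFourier.norm_fourierIntegral_le_integral_norm _ _ _ _ _).trans ?_
  have h2 : ∀ ξ : ℝ, ‖(-2 * Real.pi * Complex.I * ξ) ^ k • K ξ‖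
      = (2 * Real.pi) ^ k * (‖-ξ‖ ^ k * ‖H (-ξ)‖) := by
    intro ξ
    simp only [hK, norm_smul, norm_pow, norm_mul, norm_neg, Complex.norm_I, Complex.norm_real,
      Complex.norm_ofNat, mul_pow, Real.norm_of_nonneg Real.pi_pos.le]
    ring
  simp_rw [h2]
  rw [integral_const_mul, integral_neg_eq_self (fun ξ : ℝ => ‖ξ‖ ^ k * ‖H ξ‖) volume, mul_assoc]
  gcongr
  have := (hC (𝓕 g)).2
  rwa [Lp.norm_fourier_eq] at this

/-- For a continuous curve in `Hˢ` with `s > k + 1/2`, the `k`-th space derivative is jointly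
continuous and is bounded on compact sets of times. -/
theorem MemCkHs.iteratedDeriv_bound {s : ℝ} {k : ℕ} (hk : k + 1 / 2 < s) {J : Set ℝ}
    {u : ℝ → ℝ → ℝ} (hu : MemCkHs 0 s J u) (huc : ∀ t ∈ J, Continuous (u t)) :
    (∀ t ∈ J, ContDiff ℝ k (u t)) ∧
    ContinuousOn (fun z : ℝ × ℝ => iteratedDeriv k (u z.1) z.2) (J ×ˢ univ) ∧
    ∀ I ⊆ J, IsCompact I → ∃ B, ∀ t ∈ I, ∀ x, |iteratedDeriv k (u t) x| ≤ B := by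
  obtain ⟨C, hC⟩ := exists_norm_iteratedDeriv_le hk
  obtain ⟨g, hgc, hg⟩ := hu
  replace hgc : ContinuousOn g J := hgc.continuousOn
  have hcd : ∀ t ∈ J, ContDiff ℝ k (u t) := fun t ht => by
    obtain ⟨h, hb⟩ := hg t ht
    exact (hC _ (huc t ht) h _ hb).1
  -- The curve is continuous in time uniformly in space: the embedding applied to differences.
  have hdiff : ∀ t ∈ J, ∀ t' ∈ J, ∀ x,
      ‖iteratedDeriv k (u t) x - iteratedDeriv k (u t') x‖ ≤ C * ‖g t - g t'‖ := by
    intro t ht t' ht' x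
    obtain ⟨h, hb⟩ := hg t ht
    obtain ⟨h', hb'⟩ := hg t' ht'
    have hsub : MemLp (fun x => ((u t x - u t' x : ℝ) : ℂ)) 2 (volume : Measure ℝ) := by
      simpa using! h.sub h'
    have hLp : hsub.toLp _ = h.toLp _ - h'.toLp _ := by
      rw [← MemLp.toLp_sub]
      congr 1
      ext x
      simp
    have := (hC (fun x => u t x - u t' x) ((huc t ht).sub (huc t' ht')) hsub (g t - g t') (by
      rw [hLp]
      simp only [← Lp.toTemperedDistributionCLM_apply, map_sub] at hb hb' ⊢
      rw [hb, hb'])).2 x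
    rwa [iteratedDeriv_fun_sub (hcd t ht).contDiffAt (hcd t' ht').contDiffAt] at this
  refine ⟨hcd, ?_, ?_⟩
  · rintro ⟨t, x⟩ ⟨ht, -⟩
    have hlim : Filter.Tendsto (fun z : ℝ × ℝ => C * ‖g z.1 - g t‖
        + ‖iteratedDeriv k (u t) z.2 - iteratedDeriv k (u t) x‖)
        (nhdsWithin (t, x) (J ×ˢ univ)) (nhds 0) := by
      have h1 : Filter.Tendsto (fun z : ℝ × ℝ => g z.1) (nhdsWithin (t, x) (J ×ˢ univ))
          (nhds (g t)) :=
        (hgc t ht).tendsto.comp (tendsto_nhdsWithin_iff.2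
          ⟨(continuous_fst.tendsto (t, x)).mono_left nhdsWithin_le_nhds,
            Filter.eventually_of_mem self_mem_nhdsWithin fun z hz => hz.1⟩)
      have h2 : Filter.Tendsto (fun z : ℝ × ℝ => iteratedDeriv k (u t) z.2)
          (nhdsWithin (t, x) (J ×ˢ univ)) (nhds (iteratedDeriv k (u t) x)) :=
        ((((hcd t ht).continuous_iteratedDeriv k le_rfl).comp continuous_snd).tendsto
          (t, x)).mono_left nhdsWithin_le_nhds
      have := ((h1.sub_const (g t)).norm.const_mul C).add
        (h2.sub_const (iteratedDeriv k (u t) x)).norm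
      simpa using this
    refine tendsto_iff_norm_sub_tendsto_zero.2 (squeeze_zero' (by simp) ?_ hlim)
    filter_upwards [self_mem_nhdsWithin] with z hz
    refine (norm_sub_le_norm_sub_add_norm_sub _ (iteratedDeriv k (u t) z.2) _).trans ?_
    gcongr
    exact hdiff z.1 hz.1 t ht z.2
  · intro I hI hIc
    obtain ⟨B, hB⟩ := hIc.exists_bound_of_continuousOn (hgc.mono hI)
    refine ⟨|C| * B, fun t ht x => ?_⟩
    obtain ⟨h, hb⟩ := hg t (hI ht)
    refine ((hC _ (huc t (hI ht)) h _ hb).2 x).trans ?_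
    gcongr
    · exact le_abs_self C
    · exact hB t ht

/-! ### Propagation of zeros for the transport equation -/

/-- Smooth mollifiers of every width `ε`. The bound `M` on `∫ |z η'(z)| dz` does not depend on `ε`,
because this integral is invariant under `η ↦ ε⁻¹ η(· / ε)`. -/
theorem exists_mollifier : ∃ M : ℝ, ∀ ε : ℝ, 0 < ε → ∃ η : ℝ → ℝ, ContDiff ℝ ∞ η ∧
    HasCompactSupport η ∧ (∀ z, 0 ≤ η z) ∧ ∫ z, η z = 1 ∧
    (∀ z, ε < |z| → η z = 0 ∧ deriv η z = 0) ∧ ∫ z, |z * deriv η z| ≤ M := by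
  let β : ContDiffBump (0 : ℝ) := ⟨1 / 2, 1, by norm_num, by norm_num⟩
  set ρ : ℝ → ℝ := β.normed volume with hρ
  have hρd : ContDiff ℝ ∞ ρ := β.contDiff_normed
  refine ⟨∫ z, |z * deriv ρ z|, fun ε hε => ?_⟩
  set η : ℝ → ℝ := fun z => ε⁻¹ * ρ (z / ε) with hη
  have hη0 : ∀ z, ε < |z| → η z = 0 := by
    intro z hz
    have : z / ε ∉ Function.support ρ := by
      rw [hρ, β.support_normed_eq]
      simp only [Metric.mem_ball, dist_zero_right, Real.norm_eq_abs, abs_div, abs_of_pos hε, not_lt]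
      change 1 ≤ |z| / ε
      rw [le_div_iff₀ hε]
      linarith
    simp only [hη, Function.notMem_support.1 this, mul_zero]
  have hder : ∀ z, deriv η z = ε⁻¹ * (deriv ρ (z / ε) * ε⁻¹) := by
    intro z
    have h1 : HasDerivAt ρ (deriv ρ (z / ε)) (z / ε) :=
      (hρd.differentiable (by simp) (z / ε)).hasDerivAt
    have h2 : HasDerivAt (fun z : ℝ => z / ε) ε⁻¹ z := by
      simpa using (hasDerivAt_id z).div_const ε
    exact ((h1.comp z h2).const_mul ε⁻¹).deriv
  refine ⟨η, by fun_prop, ?_, ?_, ?_, ?_, ?_⟩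
  · refine HasCompactSupport.of_support_subset_isCompact (isCompact_Icc (a := -ε) (b := ε)) ?_
    intro z hz
    by_contra h
    exact hz (hη0 z (by rw [mem_Icc, ← abs_le] at h; exact not_le.1 h))
  · exact fun z => mul_nonneg (inv_nonneg.2 hε.le) (β.nonneg_normed _)
  · simp only [hη]
    rw [integral_const_mul, Measure.integral_comp_div, hρ, β.integral_normed, abs_of_pos hε]
    simp [hε.ne']
  · intro z hz
    refine ⟨hη0 z hz, ?_⟩
    have : η =ᶠ[𝓝 z] fun _ => 0 := by
      filter_upwards [(isOpen_lt continuous_const continuous_abs).mem_nhds hz] with y hy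
      exact hη0 y hy
    rw [this.deriv_eq]
    simp
  · have h : ∀ z, |z * deriv η z| = ε⁻¹ * (fun y => |y * deriv ρ y|) (z / ε) := by
      intro z
      rw [hder, ← abs_of_pos (inv_pos.2 hε)]
      simp only [← abs_mul]
      rw [abs_of_pos (inv_pos.2 hε)]
      congr 1
      field_simp
    simp_rw [h]
    rw [integral_const_mul, Measure.integral_comp_div (fun y => |y * deriv ρ y|) ε, abs_of_pos hε]
    simp [hε.ne']

/-- The chain rule for `F(τ, γ(τ))` within a set `I` of times: differentiability in time is only
needed at the fixed point `γ(t)`, provided the space derivative `F₂` is jointly continuous. -/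
theorem hasDerivWithinAt_comp_curve {F F₂ : ℝ → ℝ → ℝ} {I : Set ℝ} {γ : ℝ → ℝ} {t D γ' : ℝ}
    (ht : t ∈ I) (hF₁ : HasDerivWithinAt (fun τ => F τ (γ t)) D I t)
    (hF₂ : ∀ τ ∈ I, ∀ x, HasDerivAt (F τ) (F₂ τ x) x)
    (hF₂c : ContinuousOn (fun z : ℝ × ℝ => F₂ z.1 z.2) (I ×ˢ univ))
    (hγ : HasDerivWithinAt γ γ' I t) :
    HasDerivWithinAt (fun τ => F τ (γ τ)) (D + F₂ t (γ t) * γ') I t := by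
  -- The linearization error in space is `o(γ τ - γ t)` by the mean value inequality.
  have hrem :
      HasDerivWithinAt (fun τ => F τ (γ τ) - F τ (γ t) - F₂ t (γ t) * (γ τ - γ t)) 0 I t := by
    rw [hasDerivWithinAt_iff_isLittleO]
    have hO : (fun τ => γ τ - γ t) =O[𝓝[I] t] fun τ => τ - t :=
      hγ.differentiableWithinAt.isBigO_sub
    have ho : (fun τ => F τ (γ τ) - F τ (γ t) - F₂ t (γ t) * (γ τ - γ t))
        =o[𝓝[I] t] fun τ => γ τ - γ t := by
      rw [Asymptotics.isLittleO_iff]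
      intro δ hδ
      have hc := hF₂c (t, γ t) ⟨ht, trivial⟩
      rw [ContinuousWithinAt, Metric.tendsto_nhdsWithin_nhds] at hc
      obtain ⟨r, hr, hc⟩ := hc δ hδ
      have hγc : ∀ᶠ τ in 𝓝[I] t, |γ τ - γ t| < r := by
        have := hγ.continuousWithinAt (Metric.ball_mem_nhds (γ t) hr)
        filter_upwards [this] with τ hτ
        simpa [Real.dist_eq] using hτ
      have hτr : ∀ᶠ τ in 𝓝[I] t, |τ - t| < r := by
        filter_upwards [mem_nhdsWithin_of_mem_nhds (Metric.ball_mem_nhds t hr)] with τ hτ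
        simpa [Real.dist_eq] using hτ
      filter_upwards [hγc, hτr, self_mem_nhdsWithin] with τ h1 h2 hτ
      have hmv := (convex_ball (γ t) r).norm_image_sub_le_of_norm_hasDerivWithin_le
        (f := fun x => F τ x - F₂ t (γ t) * x) (f' := fun x => F₂ τ x - F₂ t (γ t))
        (x := γ t) (y := γ τ) (C := δ)
        (fun x _ => ((hF₂ τ hτ x).sub (by
          simpa using (hasDerivAt_id x).const_mul (F₂ t (γ t)))).hasDerivWithinAt)
        (fun x hx => by
          have := hc (x := (τ, x)) ⟨hτ, trivial⟩ (by
            rw [Prod.dist_eq]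
            exact max_lt (by simpa [Real.dist_eq] using h2) (by simpa using hx))
          simpa [dist_eq_norm] using this.le)
        (Metric.mem_ball_self hr) (by simpa [Real.dist_eq] using h1)
      rw [show F τ (γ τ) - F τ (γ t) - F₂ t (γ t) * (γ τ - γ t)
        = F τ (γ τ) - F₂ t (γ t) * γ τ - (F τ (γ t) - F₂ t (γ t) * γ t) by ring]
      exact hmv
    have := ho.trans_isBigO hO
    simpa using this
  have hlin := (hγ.sub_const (γ t)).const_mul (F₂ t (γ t))
  have := (hF₁.add hrem).add hlin
  refine (this.congr_deriv (by ring)).congr_of_mem (fun τ _ => ?_) ht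
  simp only [Pi.add_apply]
  ring

theorem gronwallBound_mul_left (c δ K ε x : ℝ) :
    gronwallBound (c * δ) K (c * ε) x = c * gronwallBound δ K ε x := by
  unfold gronwallBound
  split_ifs <;> ring

/-- A continuous distributional solution `w` of `w_t + c w_x + e w = 0`, with `c` of class `C¹` and
Lipschitz in space and `e` bounded, that vanishes at the initial point of a characteristic `γ`
vanishes along it. -/
theorem eq_zero_of_transport {τ : ℝ} (hτ : 0 ≤ τ) {c e w : ℝ → ℝ → ℝ} {γ : ℝ → ℝ} {L E : ℝ}
    (hc : ∀ t ∈ Icc 0 τ, ContDiff ℝ 1 (c t))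
    (hcL : ∀ t ∈ Icc 0 τ, ∀ x, |deriv (c t) x| ≤ L)
    (heE : ∀ t ∈ Icc 0 τ, ∀ x, |e t x| ≤ E)
    (hw : ContinuousOn (fun z : ℝ × ℝ => w z.1 z.2) (Icc 0 τ ×ˢ univ))
    (heq : ∀ ψ : ℝ → ℝ, ContDiff ℝ ∞ ψ → HasCompactSupport ψ → ∀ t ∈ Icc 0 τ,
      HasDerivWithinAt (fun r => ∫ x, w r x * ψ x)
        ((∫ x, w t x * deriv (fun y => c t y * ψ y) x) - ∫ x, e t x * w t x * ψ x) (Icc 0 τ) t)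
    (hγ : ∀ t ∈ Icc 0 τ, HasDerivWithinAt γ (c t (γ t)) (Icc 0 τ) t)
    (h0 : w 0 (γ 0) = 0) : w τ (γ τ) = 0 := by
  obtain ⟨M, hM⟩ := exists_mollifier
  have h0mem : (0 : ℝ) ∈ Icc 0 τ := ⟨le_rfl, hτ⟩
  have hE : 0 ≤ E := (abs_nonneg _).trans (heE 0 h0mem 0)
  have hL : 0 ≤ L := (abs_nonneg _).trans (hcL 0 h0mem 0)
  have hγc : ContinuousOn γ (Icc 0 τ) := fun t ht => (hγ t ht).continuousWithinAt
  have hwt : ∀ t ∈ Icc 0 τ, Continuous (w t) := by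
    intro t ht
    have : ContinuousOn ((fun z : ℝ × ℝ => w z.1 z.2) ∘ fun x => (t, x)) univ :=
      hw.comp (by fun_prop) (fun x _ => ⟨ht, trivial⟩)
    exact continuousOn_univ.1 this
  -- The oscillation of `w(t)` near `γ(t)` is small uniformly in `t`.
  have hosc : ∀ δ > 0, ∃ ε > 0, ∀ t ∈ Icc 0 τ, ∀ y, |γ t - y| ≤ ε → |w t y - w t (γ t)| ≤ δ := by
    intro δ hδ
    have hcont : ContinuousOn (fun z : ℝ × ℝ => w z.1 (γ z.1 - z.2)) (Icc 0 τ ×ˢ Icc (-1) 1) := by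
      have h1 : ContinuousOn (fun z : ℝ × ℝ => (z.1, γ z.1 - z.2)) (Icc 0 τ ×ˢ Icc (-1) 1) :=
        continuousOn_fst.prodMk ((hγc.comp continuousOn_fst fun z hz => hz.1).sub continuousOn_snd)
      exact hw.comp h1 fun z hz => ⟨hz.1, trivial⟩
    have hu := (isCompact_Icc.prod isCompact_Icc).uniformContinuousOn_of_continuous hcont
    obtain ⟨r, hr, hu⟩ := Metric.uniformContinuousOn_iff.1 hu δ hδ
    refine ⟨min (r / 2) 1, by positivity, fun t ht y hy => ?_⟩
    have hy1 := hy.trans (min_le_left _ _)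
    have hy2 := abs_le.1 (hy.trans (min_le_right _ _))
    have := hu (t, γ t - y) ⟨ht, hy2.1, hy2.2⟩ (t, 0) ⟨ht, by simp⟩ (by
      rw [Prod.dist_eq]
      simp only [dist_self, dist_zero_right, Real.norm_eq_abs]
      exact max_lt hr (by linarith))
    simpa [Real.dist_eq] using this.le
  -- `L * (1 + M)` bounds the `L¹` norm of the commutator kernel. The term `2 * E` comes from
  -- replacing `w t y` by `F t (γ t)` in the zeroth order term.
  set C := L * (1 + M) + 2 * E with hC
  have key : ∀ δ > 0, |w τ (γ τ)| ≤ δ * (gronwallBound 1 E C τ + 1) := by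
    intro δ hδ
    obtain ⟨ε, hε, hosc⟩ := hosc δ hδ
    obtain ⟨η, hη, hηc, hη0, hη1, hηε, hηM⟩ := hM ε hε
    have hη' : Continuous (deriv η) := hη.continuous_deriv (by simp)
    have hηint : Integrable η := hη.continuous.integrable_of_hasCompactSupport hηc
    have hzint : Integrable fun z => z * deriv η z :=
      (by fun_prop : Continuous fun z => z * deriv η z).integrable_of_hasCompactSupport
        hηc.deriv.mul_left
    -- `F` is the mollified solution and `F₂` its space derivative.
    set F : ℝ → ℝ → ℝ := fun t x => ∫ y, w t y * η (x - y) with hF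
    set F₂ : ℝ → ℝ → ℝ := fun t x => ∫ y, w t y * deriv η (x - y) with hF₂
    have hψc : ∀ {h : ℝ → ℝ}, HasCompactSupport h → ∀ x, HasCompactSupport fun y => h (x - y) :=
      fun hh x => hh.comp_homeomorph (Homeomorph.subLeft x)
    have hFd : ∀ t ∈ Icc 0 τ, ∀ x, HasDerivAt (F t) (F₂ t x) x := by
      intro t ht x
      exact hηc.hasDerivAt_convolution_right (ContinuousLinearMap.mul ℝ ℝ)
        (hwt t ht).locallyIntegrable (hη.of_le (by simp)) x
    have hF₂c : ContinuousOn (fun z : ℝ × ℝ => F₂ z.1 z.2) (Icc 0 τ ×ˢ univ) := by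
      -- After the substitution the integrand has support in a compact set independent of `z`.
      have heqF : ∀ z : ℝ × ℝ, F₂ z.1 z.2 = ∫ y, w z.1 (z.2 - y) * deriv η y := by
        intro z
        simp only [hF₂]
        rw [← integral_sub_left_eq_self (fun y => w z.1 y * deriv η (z.2 - y)) volume z.2]
        simp
      simp_rw [heqF]
      refine continuousOn_integral_of_compact_support (k := Icc (-ε) ε) isCompact_Icc ?_ ?_
      · have h1 : ContinuousOn (fun q : (ℝ × ℝ) × ℝ => (q.1.1, q.1.2 - q.2))
            ((Icc 0 τ ×ˢ univ) ×ˢ univ) := by fun_prop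
        have h2 := hw.comp h1 fun q hq => ⟨hq.1.1, trivial⟩
        exact h2.mul (hη'.comp continuous_snd).continuousOn
      · intro z y _ hy
        rw [(hηε y (by rw [mem_Icc, ← abs_le] at hy; exact not_le.1 hy)).2, mul_zero]
    have hWd : ∀ t ∈ Icc 0 τ, HasDerivWithinAt (fun r => F r (γ r))
        ((∫ y, w t y * deriv (fun z => c t z * η (γ t - z)) y)
          - (∫ y, e t y * w t y * η (γ t - y)) + F₂ t (γ t) * c t (γ t)) (Icc 0 τ) t := by
      intro t ht
      exact hasDerivWithinAt_comp_curve ht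
        (heq (fun y => η (γ t - y)) (by fun_prop) (hψc hηc _) t ht) hFd hF₂c (hγ t ht)
    -- Against a kernel supported within `ε` of `γ t`, `w t` may be replaced by its value at `γ t`.
    have havg : ∀ t ∈ Icc 0 τ, ∀ h : ℝ → ℝ, Integrable h → (∀ y, ε < |γ t - y| → h y = 0) →
        |∫ y, (w t y - w t (γ t)) * h y| ≤ δ * ∫ y, |h y| := by
      intro t ht h hh hhε
      rw [← integral_const_mul, ← Real.norm_eq_abs]
      refine norm_integral_le_of_norm_le (hh.abs.const_mul δ) (Eventually.of_forall fun y => ?_)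
      rw [norm_mul, Real.norm_eq_abs, Real.norm_eq_abs]
      by_cases hy : |γ t - y| ≤ ε
      · gcongr
        exact hosc t ht y hy
      · rw [hhε y (not_le.1 hy)]
        simp
    have hηx : ∀ x, Integrable fun y => η (x - y) := fun x => hηint.comp_sub_left x
    have hη1x : ∀ x, ∫ y, η (x - y) = 1 := fun x => by
      rw [integral_sub_left_eq_self η volume x, hη1]
    have hη1x' : ∀ x, ∫ y, |η (x - y)| = 1 := fun x => by
      simp_rw [abs_of_nonneg (hη0 _)]
      exact hη1x x
    have hwint : ∀ t ∈ Icc 0 τ, ∀ h : ℝ → ℝ, Continuous h → HasCompactSupport h →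
        Integrable fun y => w t y * h y := fun t ht h hh hhc =>
      ((hwt t ht).mul hh).integrable_of_hasCompactSupport hhc.mul_left
    have hηxc : ∀ x, Continuous fun y => η (x - y) := fun x => by
      have := hη.continuous; fun_prop
    have hFw : ∀ t ∈ Icc 0 τ, |F t (γ t) - w t (γ t)| ≤ δ := by
      intro t ht
      have h1 := havg t ht (fun y => η (γ t - y)) (hηx _) fun y hy => (hηε _ hy).1
      rw [hη1x', mul_one] at h1
      convert h1 using 2
      simp_rw [sub_mul]
      rw [integral_sub (hwint t ht _ (hηxc _) (hψc hηc _)) ((hηx _).const_mul _),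
        integral_const_mul, hη1x, mul_one]
    have hbound : ∀ t ∈ Icc 0 τ,
        |(∫ y, w t y * deriv (fun z => c t z * η (γ t - z)) y)
          - (∫ y, e t y * w t y * η (γ t - y)) + F₂ t (γ t) * c t (γ t)|
        ≤ E * |F t (γ t)| + δ * C := by
      intro t ht
      set x := γ t with hx
      have hcd : ∀ y, HasDerivAt (c t) (deriv (c t) y) y := fun y =>
        ((hc t ht).differentiable (by simp) y).hasDerivAt
      have hcc : Continuous (deriv (c t)) := (hc t ht).continuous_deriv le_rfl
      have hct : Continuous (c t) := (hc t ht).continuous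
      have hηd : ∀ y, HasDerivAt (fun y => η (x - y)) (-deriv η (x - y)) y := by
        intro y
        have h1 : HasDerivAt η (deriv η (x - y)) (x - y) :=
          (hη.differentiable (by simp) _).hasDerivAt
        have h2 : HasDerivAt (fun y => x - y) (-1) y := by
          simpa using (hasDerivAt_id y).const_sub x
        have := h1.comp y h2
        simpa using! this
      have hη'x : Continuous fun y => deriv η (x - y) := by fun_prop
      -- the commutator kernel, a total derivative
      set k : ℝ → ℝ := fun y => deriv (c t) y * η (x - y) - (c t y - c t x) * deriv η (x - y)
        with hk
      have hkd : ∀ y, HasDerivAt (fun y => (c t y - c t x) * η (x - y)) (k y) y := by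
        intro y
        refine (((hcd y).sub_const (c t x)).mul (hηd y)).congr_deriv ?_
        simp only [hk]
        ring
      have hkc : Continuous k := by
        have := hηxc x
        fun_prop
      have hkcs : HasCompactSupport k := by
        refine HasCompactSupport.sub ?_ ?_
        · exact (hψc hηc x).mul_left
        · exact (hψc hηc.deriv x).mul_left
      have hkint : Integrable k := hkc.integrable_of_hasCompactSupport hkcs
      have hk0 : ∫ y, k y = 0 := by
        refine integral_eq_zero_of_hasDerivAt_of_integrable hkd hkint ?_
        exact (by have := hηxc x; fun_prop : Continuous fun y =>
          (c t y - c t x) * η (x - y)).integrable_of_hasCompactSupport (hψc hηc x).mul_left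
      have hkabs : ∫ y, |k y| ≤ L * (1 + M) := by
        have hzx : Integrable fun y => |(x - y) * deriv η (x - y)| := (hzint.comp_sub_left x).abs
        have hzM : ∫ y, |(x - y) * deriv η (x - y)| ≤ M := by
          rw [integral_sub_left_eq_self (fun z => |z * deriv η z|) volume x]
          exact hηM
        calc ∫ y, |k y| ≤ ∫ y, (L * η (x - y) + L * |(x - y) * deriv η (x - y)|) := by
              refine integral_mono hkint.abs (((hηx x).const_mul L).add (hzx.const_mul L))
                fun y => ?_
              have hlip : |c t y - c t x| ≤ L * |x - y| := by
                have := (convex_univ (𝕜 := ℝ) (E := ℝ)).norm_image_sub_le_of_norm_hasDerivWithin_le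
                  (f := c t) (f' := deriv (c t)) (x := x) (y := y) (C := L)
                  (fun y _ => (hcd y).hasDerivWithinAt) (fun y _ => hcL t ht y) trivial trivial
                rwa [Real.norm_eq_abs, Real.norm_eq_abs, abs_sub_comm y x] at this
              simp only [hk]
              refine (abs_sub _ _).trans ?_
              rw [abs_mul, abs_mul, abs_mul, abs_of_nonneg (hη0 (x - y)), ← mul_assoc]
              have := hη0 (x - y)
              gcongr
              exact hcL t ht y
          _ = L * 1 + L * ∫ y, |(x - y) * deriv η (x - y)| := by
              rw [integral_add ((hηx x).const_mul L) (hzx.const_mul L), integral_const_mul,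
                integral_const_mul, hη1x]
          _ ≤ L * (1 + M) := by
              rw [mul_add]
              gcongr
      have hA : (∫ y, w t y * deriv (fun z => c t z * η (x - z)) y) + F₂ t x * c t x
          = ∫ y, (w t y - w t x) * k y := by
        have hdk : ∀ y, deriv (fun z => c t z * η (x - z)) y
            = k y - c t x * deriv η (x - y) := by
          intro y
          refine (((hcd y).mul (hηd y)).congr_deriv ?_).deriv
          simp only [hk]
          ring
        have hwη' := hwint t ht _ hη'x (hψc hηc.deriv x)
        have hwk := hwint t ht _ hkc hkcs
        have e1 : ∫ y, w t y * deriv (fun z => c t z * η (x - z)) y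
            = (∫ y, w t y * k y) - c t x * F₂ t x := by
          simp only [hF₂]
          rw [← integral_const_mul, ← integral_sub hwk (hwη'.const_mul _)]
          congr 1
          ext y
          rw [hdk]
          ring
        have e2 : ∫ y, (w t y - w t x) * k y = ∫ y, w t y * k y := by
          simp_rw [sub_mul]
          rw [integral_sub hwk (hkint.const_mul _), integral_const_mul, hk0]
          ring
        rw [e1, e2]
        ring
      have hA' : |∫ y, (w t y - w t x) * k y| ≤ δ * (L * (1 + M)) := by
        refine (havg t ht k hkint fun y hy => ?_).trans (by gcongr)
        simp only [hk]
        rw [(hηε _ hy).1, (hηε _ hy).2]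
        ring
      have hB : |∫ y, e t y * w t y * η (x - y)| ≤ E * (|F t x| + 2 * δ) := by
        have hwx : |w t x| ≤ |F t x| + δ := by
          have h1 := hFw t ht
          rw [← hx, abs_sub_comm] at h1
          have := abs_add_le (F t x) (w t x - F t x)
          rw [add_sub_cancel] at this
          linarith
        have hb : ‖∫ y, e t y * w t y * η (x - y)‖
            ≤ ∫ y, E * (|F t x| + 2 * δ) * η (x - y) := by
          refine norm_integral_le_of_norm_le ((hηx x).const_mul _) (Eventually.of_forall fun y => ?_)
          rw [norm_mul, norm_mul, Real.norm_eq_abs, Real.norm_eq_abs, Real.norm_eq_abs,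
            abs_of_nonneg (hη0 (x - y))]
          by_cases hy : |x - y| ≤ ε
          · have h1 := hosc t ht y hy
            have h2 : |w t y| ≤ |F t x| + 2 * δ := by
              have := abs_add_le (w t x) (w t y - w t x)
              rw [add_sub_cancel] at this
              linarith
            have := hη0 (x - y)
            gcongr
            exact heE t ht y
          · rw [(hηε _ (not_le.1 hy)).1]
            simp
        rwa [integral_const_mul, hη1x, mul_one] at hb
      rw [sub_add_eq_add_sub, hA]
      refine (abs_sub _ _).trans ?_
      rw [hC]
      linarith
    have hmem : ∀ t ∈ Ico 0 τ, Icc 0 τ ∈ 𝓝[Ici t] t := fun t ht =>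
      mem_nhdsWithin.2 ⟨Iio τ, isOpen_Iio, ht.2, fun y hy => ⟨ht.1.trans hy.2, hy.1.le⟩⟩
    have hgr := norm_le_gronwallBound_of_norm_deriv_right_le (f := fun r => F r (γ r))
      (δ := δ) (K := E) (ε := δ * C) (a := 0) (b := τ)
      (fun t ht => (hWd t ht).continuousWithinAt)
      (fun t ht => (hWd t (Ico_subset_Icc_self ht)).mono_of_mem_nhdsWithin (hmem t ht))
      (by simpa [h0] using hFw 0 h0mem)
      (fun t ht => hbound t (Ico_subset_Icc_self ht)) τ ⟨hτ, le_rfl⟩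
    rw [sub_zero, ← mul_one δ, mul_assoc, one_mul, gronwallBound_mul_left, Real.norm_eq_abs] at hgr
    have h1 := hFw τ ⟨hτ, le_rfl⟩
    rw [abs_sub_comm] at h1
    have := abs_add_le (F τ (γ τ)) (w τ (γ τ) - F τ (γ τ))
    rw [add_sub_cancel] at this
    linarith
  have hlim : Tendsto (fun δ : ℝ => δ * (gronwallBound 1 E C τ + 1)) (𝓝[>] 0) (𝓝 0) := by
    have : Continuous fun δ : ℝ => δ * (gronwallBound 1 E C τ + 1) := by fun_prop
    simpa using (this.tendsto 0).mono_left nhdsWithin_le_nhds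
  have := ge_of_tendsto hlim (eventually_mem_nhdsWithin.mono fun δ hδ => key δ hδ)
  exact abs_nonpos_iff.1 this

/-! ### Flows of bounded Lipschitz vector fields -/

theorem hasDerivWithinAt_Ici_of_Icc {τ t : ℝ} (ht : t ∈ Ico 0 τ) {α : ℝ → ℝ} {α' : ℝ}
    (h : HasDerivWithinAt α α' (Icc 0 τ) t) : HasDerivWithinAt α α' (Ici t) t :=
  h.mono_of_mem_nhdsWithin <|
    mem_nhdsWithin.2 ⟨Iio τ, isOpen_Iio, ht.2, fun _ hy => ⟨ht.1.trans hy.2, hy.1.le⟩⟩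

/-- A bounded Lipschitz field has an integral curve on all of `[0, τ]` with a prescribed value at any
time `t₀`. In the Picard-Lindelöf theorem the ball of radius `B * τ` is never left. -/
theorem exists_integralCurve {V : ℝ → ℝ → ℝ} {B : ℝ≥0} {τ t₀ : ℝ} (ht₀ : t₀ ∈ Icc 0 τ)
    (hVc : ContinuousOn (fun z : ℝ × ℝ => V z.1 z.2) (Icc 0 τ ×ˢ univ))
    (hVb : ∀ t ∈ Icc 0 τ, ∀ x, |V t x| ≤ B) (hVl : ∀ t ∈ Icc 0 τ, LipschitzWith B (V t)) (x : ℝ) :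
    ∃ α : ℝ → ℝ, α t₀ = x ∧ ∀ t ∈ Icc 0 τ, HasDerivWithinAt α (V t (α t)) (Icc 0 τ) t := by
  have hτ : 0 ≤ τ := ht₀.1.trans ht₀.2
  have h : IsPicardLindelof V (⟨t₀, ht₀⟩ : Icc 0 τ) x (B * τ.toNNReal) 0 B B :=
    { lipschitzOnWith := fun t ht => (hVl t ht).lipschitzOnWith
      continuousOn := fun y _ => hVc.comp (f := fun t => (t, y)) (by fun_prop)
        fun t ht => ⟨ht, trivial⟩
      norm_le := fun t ht y _ => hVb t ht y
      mul_max_le := by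
        rw [NNReal.coe_mul, Real.coe_toNNReal τ hτ, NNReal.coe_zero, sub_zero, sub_zero]
        have hmax : max (τ - t₀) t₀ ≤ τ := max_le (by linarith [ht₀.1]) ht₀.2
        exact mul_le_mul_of_nonneg_left hmax B.2 }
  exact h.exists_eq_forall_mem_Icc_hasDerivWithinAt₀

theorem dist_integralCurve_le {V : ℝ → ℝ → ℝ} {B : ℝ≥0} {τ : ℝ}
    (hVl : ∀ t ∈ Icc 0 τ, LipschitzWith B (V t)) {α β : ℝ → ℝ}
    (hα : ∀ t ∈ Icc 0 τ, HasDerivWithinAt α (V t (α t)) (Icc 0 τ) t)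
    (hβ : ∀ t ∈ Icc 0 τ, HasDerivWithinAt β (V t (β t)) (Icc 0 τ) t) {t : ℝ} (ht : t ∈ Icc 0 τ) :
    dist (α t) (β t) ≤ dist (α 0) (β 0) * Real.exp (B * t) := by
  have := dist_le_of_trajectories_ODE_of_mem (s := fun _ => univ)
    (fun t ht => (hVl t (Ico_subset_Icc_self ht)).lipschitzOnWith)
    (fun t ht => (hα t ht).continuousWithinAt)
    (fun t ht => hasDerivWithinAt_Ici_of_Icc ht (hα t (Ico_subset_Icc_self ht)))
    (fun _ _ => trivial)
    (fun t ht => (hβ t ht).continuousWithinAt)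
    (fun t ht => hasDerivWithinAt_Ici_of_Icc ht (hβ t (Ico_subset_Icc_self ht)))
    (fun _ _ => trivial) le_rfl t ht
  rwa [sub_zero] at this

theorem Icc_subset_timeInterval {T : EReal} {τ : ℝ} (hτ : τ ∈ timeInterval T) :
    Icc 0 τ ⊆ timeInterval T := fun _ ht =>
  ⟨ht.1, (EReal.coe_le_coe_iff.2 ht.2).trans_lt hτ.2⟩

theorem exists_gt_mem_timeInterval {T : EReal} {t : ℝ} (ht : t ∈ timeInterval T) :
    ∃ τ ∈ timeInterval T, t < τ := by
  obtain ⟨τ, h1, h2⟩ := EReal.lt_iff_exists_real_btwn.1 ht.2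
  have h1 := EReal.coe_lt_coe_iff.1 h1
  exact ⟨τ, ⟨ht.1.trans h1.le, h2⟩, h1⟩

section Flow

variable {T : EReal} {V φ : ℝ → ℝ → ℝ}

/-- Flows on the intervals `[0, τ]`, `τ < T`, agree by uniqueness and glue to a flow on `[0, T)`. -/
theorem exists_isFlow
    (hVc : ContinuousOn (fun z : ℝ × ℝ => V z.1 z.2) (timeInterval T ×ˢ univ))
    (hV : ∀ τ ∈ timeInterval T, ∃ B : ℝ≥0, ∀ t ∈ Icc 0 τ,
      (∀ x, |V t x| ≤ B) ∧ LipschitzWith B (V t)) :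
    ∃ φ, IsFlow (timeInterval T) V φ := by
  classical
  have hex : ∀ t ∈ timeInterval T, ∀ x, ∃ α : ℝ → ℝ, α 0 = x ∧
      ∀ r ∈ Icc 0 t, HasDerivWithinAt α (V r (α r)) (Icc 0 t) r := by
    intro t ht x
    obtain ⟨B, hB⟩ := hV t ht
    exact exists_integralCurve ⟨le_rfl, ht.1⟩
      (hVc.mono (prod_mono (Icc_subset_timeInterval ht) le_rfl))
      (fun r hr => (hB r hr).1) (fun r hr => (hB r hr).2) x
  choose! α hα0 hα using hex
  have hcompat : ∀ t ∈ timeInterval T, ∀ t' ∈ timeInterval T, t ≤ t' → ∀ x, ∀ r ∈ Icc 0 t,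
      α t' x r = α t x r := by
    intro t ht t' ht' htt x r hr
    obtain ⟨B, hB⟩ := hV t ht
    have hsub : Icc 0 t ⊆ Icc 0 t' := Icc_subset_Icc_right htt
    have := dist_integralCurve_le (fun r hr => (hB r hr).2)
      (fun r hr => (hα t' ht' x r (hsub hr)).mono hsub) (hα t ht x) hr
    rw [hα0 t' ht', hα0 t ht, dist_self, zero_mul] at this
    exact dist_le_zero.1 this
  choose! σ hσ hσt using fun t (ht : t ∈ timeInterval T) => exists_gt_mem_timeInterval ht
  -- The curve on `[0, t]` is read off at its endpoint. The value outside `[0, T)` matters only at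
  -- time `0`, when the interval is empty.
  refine ⟨fun t x => if t ∈ timeInterval T then α t x t else x, fun x => ⟨?_, fun t ht => ?_⟩⟩
  · dsimp only
    split_ifs with h
    · exact hα0 0 h x
    · rfl
  · have heq : ∀ r ∈ Icc 0 (σ t),
        (if r ∈ timeInterval T then α r x r else x) = α (σ t) x r := by
      intro r hr
      have hrT := Icc_subset_timeInterval (hσ t ht) hr
      rw [if_pos hrT, hcompat r hrT _ (hσ t ht) hr.2 x r ⟨hr.1, le_rfl⟩]
    have htm : t ∈ Icc 0 (σ t) := ⟨ht.1, (hσt t ht).le⟩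
    have hd := (hα (σ t) (hσ t ht) x t htm).congr_of_mem heq htm
    dsimp only
    rw [heq t htm]
    refine hd.mono_of_mem_nhdsWithin ?_
    exact mem_nhdsWithin.2 ⟨Iio (σ t), isOpen_Iio, hσt t ht, fun y hy => ⟨hy.2.1, hy.1.le⟩⟩

theorem IsFlow.continuous (hφ : IsFlow (timeInterval T) V φ) {τ : ℝ} (hτ : τ ∈ timeInterval T)
    {B : ℝ≥0} (hVl : ∀ t ∈ Icc 0 τ, LipschitzWith B (V t)) : Continuous (φ τ) := by
  have hsub := Icc_subset_timeInterval hτ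
  refine (LipschitzWith.of_dist_le_mul (K := Real.toNNReal (Real.exp (B * τ)))
    fun x y => ?_).continuous
  have := dist_integralCurve_le hVl (fun t ht => ((hφ x).2 t (hsub ht)).mono hsub)
    (fun t ht => ((hφ y).2 t (hsub ht)).mono hsub) ⟨hτ.1, le_rfl⟩
  rw [(hφ x).1, (hφ y).1] at this
  rwa [Real.coe_toNNReal _ (Real.exp_pos _).le, mul_comm]

/-- A preimage of `y` under the time-`τ` map is found by solving the equation backward from `y`. -/
theorem IsFlow.surjective (hφ : IsFlow (timeInterval T) V φ) {τ : ℝ} (hτ : τ ∈ timeInterval T)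
    (hVc : ContinuousOn (fun z : ℝ × ℝ => V z.1 z.2) (timeInterval T ×ˢ univ))
    {B : ℝ≥0} (hVb : ∀ t ∈ Icc 0 τ, ∀ x, |V t x| ≤ B)
    (hVl : ∀ t ∈ Icc 0 τ, LipschitzWith B (V t)) : Function.Surjective (φ τ) := by
  intro y
  have hsub := Icc_subset_timeInterval hτ
  have hτm : τ ∈ Icc 0 τ := ⟨hτ.1, le_rfl⟩
  obtain ⟨α, hα, hαd⟩ := exists_integralCurve hτm (hVc.mono (prod_mono hsub le_rfl)) hVb hVl y
  refine ⟨α 0, ?_⟩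
  have := dist_integralCurve_le hVl (fun t ht => ((hφ (α 0)).2 t (hsub ht)).mono hsub) hαd hτm
  rw [(hφ (α 0)).1, dist_self, zero_mul] at this
  rw [dist_le_zero.1 this, hα]

end Flow

/-! ### Regularity and support of the momentum densities -/

/-- Existence of the characteristic flow and propagation of the support for one of the two
equations. -/
theorem transport_support {s : ℝ} (hs : 5 / 2 < s) {T : EReal} {p : ℕ} {a : ℝ}
    {u c : ℝ → ℝ → ℝ}
    (hu : MemCkHs 0 s (timeInterval T) u) (huc : ∀ t ∈ timeInterval T, Continuous (u t))
    (hc : MemCkHs 0 s (timeInterval T) c) (hcc : ∀ t ∈ timeInterval T, Continuous (c t))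
    (heq : SolvesTransport (timeInterval T) p a c (fun t => helmholtz (u t))) :
    (∃ φ, IsFlow (timeInterval T) (fun t x => c t x ^ p) φ) ∧
    (HasCompactSupport (helmholtz (u 0)) → ∀ t ∈ timeInterval T,
      HasCompactSupport (helmholtz (u t)) ∧
      ∀ φ, IsFlow (timeInterval T) (fun t x => c t x ^ p) φ →
        tsupport (helmholtz (u t)) ⊆ φ t '' tsupport (helmholtz (u 0))) := by
  set J := timeInterval T with hJ
  obtain ⟨-, hu0, -⟩ := hu.iteratedDeriv_bound (k := 0) (by norm_num; linarith) huc
  obtain ⟨-, hu2, -⟩ := hu.iteratedDeriv_bound (k := 2) (by norm_num; linarith) huc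
  obtain ⟨-, hc0, hcb0⟩ := hc.iteratedDeriv_bound (k := 0) (by norm_num; linarith) hcc
  obtain ⟨hcd, -, hcb1⟩ := hc.iteratedDeriv_bound (k := 1) (by norm_num; linarith) hcc
  simp only [iteratedDeriv_zero, iteratedDeriv_succ] at hu0 hu2 hc0 hcb0 hcb1
  have hw : ContinuousOn (fun z : ℝ × ℝ => helmholtz (u z.1) z.2) (J ×ˢ univ) := hu0.sub hu2
  have hVc : ContinuousOn (fun z : ℝ × ℝ => c z.1 z.2 ^ p) (J ×ˢ univ) := hc0.pow p
  have hVd : ∀ t ∈ J, ContDiff ℝ 1 fun x => c t x ^ p := fun t ht => (hcd t ht).pow p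
  have hVder : ∀ t ∈ J, ∀ x, deriv (fun x => c t x ^ p) x
      = p * c t x ^ (p - 1) * deriv (c t) x := fun t ht x =>
    (((hcd t ht).differentiable (by simp) x).hasDerivAt.pow p).deriv
  -- These bounds are uniform on compact time intervals, which makes the field globally Lipschitz.
  have hbd : ∀ τ ∈ J, ∃ B : ℝ≥0, ∀ t ∈ Icc 0 τ, ∀ x, |c t x ^ p| ≤ B ∧
      |deriv (fun x => c t x ^ p) x| ≤ B ∧ |a * c t x ^ (p - 1) * deriv (c t) x| ≤ B := by
    intro τ hτ
    have hsub := Icc_subset_timeInterval hτ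
    obtain ⟨B₀, hB₀⟩ := hcb0 _ hsub isCompact_Icc
    obtain ⟨B₁, hB₁⟩ := hcb1 _ hsub isCompact_Icc
    have h0 : 0 ≤ B₀ := (abs_nonneg _).trans (hB₀ 0 ⟨le_rfl, hτ.1⟩ 0)
    have h1 : 0 ≤ B₁ := (abs_nonneg _).trans (hB₁ 0 ⟨le_rfl, hτ.1⟩ 0)
    refine ⟨⟨max (B₀ ^ p) (max (p * B₀ ^ (p - 1) * B₁) (|a| * B₀ ^ (p - 1) * B₁)),
      (pow_nonneg h0 p).trans (le_max_left _ _)⟩, fun t ht x => ⟨?_, ?_, ?_⟩⟩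
    · rw [abs_pow]
      refine le_trans ?_ (le_max_left _ _)
      gcongr
      exact hB₀ t ht x
    · rw [hVder t (hsub ht), abs_mul, abs_mul, abs_pow, Nat.abs_cast]
      refine le_trans ?_ ((le_max_left _ _).trans (le_max_right _ _))
      gcongr
      · exact hB₀ t ht x
      · exact hB₁ t ht x
    · rw [abs_mul, abs_mul, abs_pow]
      refine le_trans ?_ ((le_max_right _ _).trans (le_max_right _ _))
      gcongr
      · exact hB₀ t ht x
      · exact hB₁ t ht x
  have hlip : ∀ τ ∈ J, ∃ B : ℝ≥0, ∀ t ∈ Icc 0 τ,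
      (∀ x, |c t x ^ p| ≤ B) ∧ LipschitzWith B fun x => c t x ^ p := by
    intro τ hτ
    obtain ⟨B, hB⟩ := hbd τ hτ
    refine ⟨B, fun t ht => ⟨fun x => (hB t ht x).1, ?_⟩⟩
    refine lipschitzWith_of_nnnorm_deriv_le
      ((hVd t (Icc_subset_timeInterval hτ ht)).differentiable (by simp)) fun x => ?_
    exact (hB t ht x).2.1
  obtain ⟨φ₀, hφ₀⟩ := exists_isFlow hVc hlip
  refine ⟨⟨φ₀, hφ₀⟩, fun hcs τ hτ => ?_⟩
  have hsub := Icc_subset_timeInterval hτ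
  obtain ⟨B, hB⟩ := hbd τ hτ
  obtain ⟨K, hK⟩ := hlip τ hτ
  have himage : ∀ φ, IsFlow J (fun t x => c t x ^ p) φ →
      IsCompact (φ τ '' tsupport (helmholtz (u 0))) ∧
      tsupport (helmholtz (u τ)) ⊆ φ τ '' tsupport (helmholtz (u 0)) := by
    intro φ hφ
    have hcomp : IsCompact (φ τ '' tsupport (helmholtz (u 0))) :=
      hcs.isCompact.image (hφ.continuous hτ fun t ht => (hK t ht).2)
    refine ⟨hcomp, closure_minimal (fun y hy => ?_) hcomp.isClosed⟩
    -- A point `φ τ x` where `helmholtz (u τ)` is nonzero starts where `helmholtz (u 0)` is nonzero.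
    obtain ⟨x, rfl⟩ := hφ.surjective hτ hVc (fun t ht => (hK t ht).1) (fun t ht => (hK t ht).2) y
    refine mem_image_of_mem _ (subset_tsupport _ fun hx => hy ?_)
    refine eq_zero_of_transport (w := fun t => helmholtz (u t)) (γ := fun t => φ t x) hτ.1
      (c := fun t x => c t x ^ p) (e := fun t x => a * c t x ^ (p - 1) * deriv (c t) x)
      (fun t ht => hVd t (hsub ht)) (fun t ht x => (hB t ht x).2.1)
      (fun t ht x => (hB t ht x).2.2) (hw.mono (prod_mono hsub le_rfl))
      (fun ψ hψ hψc t ht => (heq ψ hψ hψc t (hsub ht)).mono hsub)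
      (fun t ht => ((hφ x).2 t (hsub ht)).mono hsub) ?_
    rw [(hφ x).1]
    exact hx
  refine ⟨?_, fun φ hφ => (himage φ hφ).2⟩
  exact (himage φ₀ hφ₀).1.of_isClosed_subset (isClosed_tsupport _) (himage φ₀ hφ₀).2

theorem contDiff_helmholtz {n : ℕ} {f : ℝ → ℝ} (hf : ContDiff ℝ (n + 2 : ℕ) f) :
    ContDiff ℝ n (helmholtz f) := by
  refine (hf.of_le (by exact_mod_cast Nat.le_add_right n 2)).sub ?_
  have h1 : ContDiff ℝ (n + 1 : ℕ) (deriv f) := by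
    refine ContDiff.deriv' (n := ((n + 1 : ℕ) : WithTop ℕ∞)) ?_
    exact_mod_cast hf
  exact ContDiff.deriv' (by exact_mod_cast h1)

theorem MemCkHs.helmholtz_regularity {s : ℝ} (hs : 5 / 2 < s) {J : Set ℝ} {u : ℝ → ℝ → ℝ}
    (hu : MemCkHs 0 s J u) (huc : ∀ t ∈ J, Continuous (u t)) {t : ℝ} (ht : t ∈ J) :
    Continuous (helmholtz (u t)) ∧ (7 / 2 < s → ContDiff ℝ 1 (helmholtz (u t))) := by
  refine ⟨?_, fun hs' => ?_⟩
  · have h := (hu.iteratedDeriv_bound (k := 2) (by norm_num; linarith) huc).1 t ht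
    exact (contDiff_helmholtz (n := 0) h).continuous
  · have h := (hu.iteratedDeriv_bound (k := 3) (by norm_num; linarith) huc).1 t ht
    exact_mod_cast contDiff_helmholtz (n := 1) h

end CrossCoupledCH

theorem theorem1p6 (p q : ℕ) (hp : 1 ≤ p) (hq : 1 ≤ q) (a b s : ℝ) (hs : 5 / 2 < s)
    (u₀ v₀ : ℝ → ℝ) (hu₀c : Continuous u₀) (hv₀c : Continuous v₀)
    (hu₀ : CrossCoupledCH.MemHs s u₀) (hv₀ : CrossCoupledCH.MemHs s v₀)
    (T : EReal) (hT : 0 < T) (u v : ℝ → ℝ → ℝ)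
    (huv : CrossCoupledCH.IsSolution p q a b s T u₀ v₀ u v) :
    -- regularity of `m(·, t)` and `n(·, t)`
    (∀ t ∈ CrossCoupledCH.timeInterval T,
      (Continuous (CrossCoupledCH.helmholtz (u t)) ∧
        Continuous (CrossCoupledCH.helmholtz (v t))) ∧
      (7 / 2 < s → ContDiff ℝ 1 (CrossCoupledCH.helmholtz (u t)) ∧
        ContDiff ℝ 1 (CrossCoupledCH.helmholtz (v t)))) ∧
    -- existence of the characteristic flows
    (∃ φ : ℝ → ℝ → ℝ,
      CrossCoupledCH.IsFlow (CrossCoupledCH.timeInterval T) (fun t x => v t x ^ p) φ) ∧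
    (∃ φ : ℝ → ℝ → ℝ,
      CrossCoupledCH.IsFlow (CrossCoupledCH.timeInterval T) (fun t x => u t x ^ q) φ) ∧
    -- the support of `m(·, t)`
    (HasCompactSupport (CrossCoupledCH.helmholtz u₀) →
      ∀ t ∈ CrossCoupledCH.timeInterval T,
        HasCompactSupport (CrossCoupledCH.helmholtz (u t)) ∧
        ∀ φ : ℝ → ℝ → ℝ,
          CrossCoupledCH.IsFlow (CrossCoupledCH.timeInterval T) (fun t x => v t x ^ p) φ →
          tsupport (CrossCoupledCH.helmholtz (u t)) ⊆
            φ t '' tsupport (CrossCoupledCH.helmholtz u₀)) ∧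
    -- the support of `n(·, t)`
    (HasCompactSupport (CrossCoupledCH.helmholtz v₀) →
      ∀ t ∈ CrossCoupledCH.timeInterval T,
        HasCompactSupport (CrossCoupledCH.helmholtz (v t)) ∧
        ∀ φ : ℝ → ℝ → ℝ,
          CrossCoupledCH.IsFlow (CrossCoupledCH.timeInterval T) (fun t x => u t x ^ q) φ →
          tsupport (CrossCoupledCH.helmholtz (v t)) ⊆
            φ t '' tsupport (CrossCoupledCH.helmholtz v₀)) := by
  have hreg : ∀ t ∈ CrossCoupledCH.timeInterval T, _ := fun t ht =>
    And.intro (huv.mem_u.helmholtz_regularity hs huv.continuous_u ht)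
      (huv.mem_v.helmholtz_regularity hs huv.continuous_v ht)
  have hm := CrossCoupledCH.transport_support hs huv.mem_u huv.continuous_u huv.mem_v
    huv.continuous_v huv.eq_m
  have hn := CrossCoupledCH.transport_support hs huv.mem_v huv.continuous_v huv.mem_u
    huv.continuous_u huv.eq_n
  rw [huv.init_u] at hm
  rw [huv.init_v] at hn
  exact ⟨fun t ht => ⟨⟨(hreg t ht).1.1, (hreg t ht).2.1⟩,
    fun h => ⟨(hreg t ht).1.2 h, (hreg t ht).2.2 h⟩⟩, hm.1, hn.1, hm.2, hn.2⟩
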